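/- Let $G=(V,E)$, $V=\{v_1,\dots,v_N\}$, be a finite graph (multiple edges allowed, no loops) together with a planar embedding: vertices are distinct points of the plane, and edges are simple (polygonal) arcs joining their ends, whose interiors contain no vertices and are pairwise disjoint. Assume that $G$ is triangulated, i.e. $G$ is biconnected and every face of the embedding, including the unbounded one, is bounded by a triangle of $G$. The expanded dual graph $G^*=(V^*,E^*)$ of $G$ is obtained from the dual graph of $G$ (one vertex per face; for each edge of $G$ one edge joining the two faces on whose boundary it lies) by replacing each vertex $f$ by a triangle $K_3$ (a Fisher city) in such a way that each vertex of this triangle is incident to exactly one of the three dual edges at $f$. Explicitly, the vertices of $G^*$ are the pairs $(f,e)$ of a face $f$ and an edge $e$ on the boundary of $f$; $(f,e)$ and $(f,e')$ are adjacent for $e\ne e'$ (city edges), and $(f,e)$ and $(f',e)$ are adjacent for $f\neq f'$ (intercity edges; their set is denoted by $E^*_I$). For the intercity edge $e^*$ joining $(f,e)$ and $(f',e)$ put $g(e^*)=e$. Let $\mathrm{PM}(G^*)$ be the set of perfect matchings of $G^*$. For a spin configuration $X=(x_1,\dots,x_N)\in\{-1,+1\}^N$ let $$I(X)=\{e^*\in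 E^*_I : g(e^*)=\{v,w\},\ x_v=x_w\}.$$ Then there is exactly one perfect matching $M(X)\in\mathrm{PM}(G^*)$ with $M(X)\cap E^*_I=I(X)$, i.e. $I(X)$ is uniquely completed to a perfect matching by edges inside the Fisher cities. Moreover, the map $X\mapsto M(X)$ restricts to a bijection from $\mathcal C_+=\{X\in\{-1,+1\}^N : x_1=+1\}$ onto $\mathrm{PM}(G^*)$. -/

import Mathlib

open Set
open scoped Graph

/-- Any two vertices of the multigraph `G` are joined by a path. -/
def Graph.IsPreconnected {α β : Type*} (G : Graph α β) : Prop :=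
  ∀ u ∈ V(G), ∀ v ∈ V(G), Relation.ReflTransGen G.Adj u v

/-- `G` is biconnected: it is connected and has no articulation point. -/
def Graph.IsBiconnected {α β : Type*} (G : Graph α β) : Prop :=
  V(G).Nonempty ∧ G.IsPreconnected ∧ ∀ v ∈ V(G), (G.deleteVerts {v}).IsPreconnected

/-- The polygonal curve with corners `q 0, q 1, q 2, …`: on the parameter interval `[i, i + 1]`
it runs along the straight segment from `q i` to `q (i + 1)`. -/
noncomputable def polyline (q : ℕ → ℂ) (t : ℝ) : ℂ :=
  AffineMap.lineMap (q ⌊t⌋₊) (q (⌊t⌋₊ + 1)) (t - ⌊t⌋₊)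

/-- A planar embedding of the multigraph `G`, that is, a drawing of `G` in the plane without edge
intersections. Vertices are distinct points, and every edge is drawn as a simple polygonal arc that
joins its two ends, and whose interior meets no vertex and no other edge.
(An edge is a simple arc, so a graph that has a planar embedding in this sense has no loops.) -/
structure PlaneEmbedding {α β : Type*} (G : Graph α β) where
  /-- The point at which a vertex is drawn. -/
  pos : α → ℂ
  /-- The number of segments of the arc of an edge. -/
  len : β → ℕ
  /-- The corners of the arc of `e`; only those with index at most `len e` matter. -/
  corner : β → ℕ → ℂ
  pos_injOn : InjOn pos V(G)
  len_pos : ∀ e ∈ E(G), 0 < len e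
  ends : ∀ e ∈ E(G), ∃ u v, G.IsLink e u v ∧ corner e 0 = pos u ∧ corner e (len e) = pos v
  simple : ∀ e ∈ E(G), InjOn (polyline (corner e)) (Icc 0 (len e : ℝ))
  vertex_notMem : ∀ e ∈ E(G), ∀ v ∈ V(G), pos v ∉ polyline (corner e) '' Ioo 0 (len e : ℝ)
  edge_disjoint : ∀ e ∈ E(G), ∀ e' ∈ E(G), e ≠ e' →
    Disjoint (polyline (corner e) '' Ioo 0 (len e : ℝ)) (polyline (corner e') '' Ioo 0 (len e' : ℝ))

namespace PlaneEmbedding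

variable {α β : Type*} {G : Graph α β}

/-- The arc (with its end points) along which the edge `e` is drawn. -/
def arc (D : PlaneEmbedding G) (e : β) : Set ℂ :=
  polyline (D.corner e) '' Icc 0 (D.len e : ℝ)

/-- The set of all points of the drawing. -/
def support (D : PlaneEmbedding G) : Set ℂ :=
  D.pos '' V(G) ∪ ⋃ e ∈ E(G), D.arc e

/-- The faces of the drawing (the unbounded one included): the connected components of the
complement of the drawing in the plane. -/
def Face (D : PlaneEmbedding G) : Type :=
  {f : Set ℂ // ∃ z ∈ D.supportᶜ, f = connectedComponentIn D.supportᶜ z}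

/-- The edge `e` of `G` lies on the boundary of the face `f`. -/
def Borders (D : PlaneEmbedding G) (e : β) (f : D.Face) : Prop :=
  e ∈ E(G) ∧ D.arc e ⊆ frontier f.1

/-- The boundary of the face `f` is a triangle of `G`. -/
def IsTriangle (D : PlaneEmbedding G) (f : D.Face) : Prop :=
  ∃ u v w a b c, u ≠ v ∧ v ≠ w ∧ w ≠ u ∧ G.IsLink a u v ∧ G.IsLink b v w ∧ G.IsLink c w u ∧
    frontier f.1 = D.arc a ∪ D.arc b ∪ D.arc c

/-- The embedded graph is triangulated: it is biconnected and every face, the unbounded one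
included, is bounded by a triangle. -/
def IsTriangulated (D : PlaneEmbedding G) : Prop :=
  G.IsBiconnected ∧ ∀ f : D.Face, D.IsTriangle f

/-- The vertices of the expanded dual graph. The vertex `(f, e)` is the corner of the Fisher city
of the face `f` from which the dual edge that crosses the edge `e` leaves the city. -/
@[ext]
structure DualVertex (D : PlaneEmbedding G) where
  face : D.Face
  edge : β
  borders : D.Borders edge face

/-- The expanded dual graph `G*`: the dual graph (one vertex for each face of `G`, one edge for each
edge `e` of `G`, joining the two faces on whose boundary `e` lies) in which every vertex is replaced
by a Fisher city. Two vertices in the same city are adjacent, and the vertices `(f, e)` and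
`(f', e)`, for two faces `f ≠ f'` that share `e`, are adjacent. -/
def expandedDual (D : PlaneEmbedding G) : SimpleGraph D.DualVertex where
  Adj x y := (x.face = y.face ∧ x.edge ≠ y.edge) ∨ (x.face ≠ y.face ∧ x.edge = y.edge)
  symm := ⟨fun _ _ h => h.imp (fun h => ⟨h.1.symm, h.2.symm⟩) (fun h => ⟨h.1.symm, h.2.symm⟩)⟩
  loopless := ⟨fun _ h => h.elim (fun h => h.2 rfl) (fun h => h.1 rfl)⟩

/-- The intercity edges of `G*`: those whose two ends are in different Fisher cities. -/
def intercity (D : PlaneEmbedding G) : Set (Sym2 D.DualVertex) :=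
  {s | s ∈ D.expandedDual.edgeSet ∧ ∃ x y, s = s(x, y) ∧ x.face ≠ y.face}

/-- The intercity edge `s` crosses the edge `e` of `G` (so that `g s = e` for the correspondence `g`
between intercity edges and edges of `G`). -/
def Crosses (D : PlaneEmbedding G) (s : Sym2 D.DualVertex) (e : β) : Prop :=
  s ∈ D.intercity ∧ ∀ x ∈ s, x.edge = e

/-- `I(X)`: the intercity edges that cross an edge of `G` whose two ends have equal spins. A spin
configuration is a function with values in `ℤˣ = {1, -1}`. -/
def equalSpin (D : PlaneEmbedding G) (X : V(G) → ℤˣ) : Set (Sym2 D.DualVertex) :=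
  {s | ∃ (e : β) (v w : V(G)), D.Crosses s e ∧ G.IsLink e v w ∧ X v = X w}

/-- `P` is a perfect matching of `G*` that consists of `I(X)` and of edges inside Fisher cities. -/
def IsCompletion (D : PlaneEmbedding G) (X : V(G) → ℤˣ) (P : D.expandedDual.Subgraph) : Prop :=
  P.IsPerfectMatching ∧ P.edgeSet ∩ D.intercity = D.equalSpin X

/-- The map `M`: the perfect matching of `G*` that completes `I(X)` by edges inside Fisher cities
(with an arbitrary value if there were none). -/
noncomputable def matching (D : PlaneEmbedding G) (X : V(G) → ℤˣ) : D.expandedDual.Subgraph :=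
  Classical.epsilon (D.IsCompletion X)

end PlaneEmbedding

/-! A perfect matching is determined by the set `S` of edges of `G` that its intercity edges cross.
In each city the corners not in `S` must be paired inside a triangle, so none or exactly two of the
three are left over, and the pairing is then forced. Hence perfect matchings correspond to the edge
sets satisfying `IsFaceEven` (`eq_completion`, `isPerfectMatching_completion`,
`isFaceEven_crossed`).

Around a triangle the spin changes an even number of times, so `equalEdges X` is such a set.
Conversely, the indicator `c` of the complement of `S` has sum zero mod 2 around every face, and it
must be shown to be a coboundary, i.e. to sum to zero along every closed walk (`exists_coboundary`).
Connectedness then fixes `X` once the spin at `v₁` is given.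

Winding numbers provide the topology. The angle under which a closed walk is seen is `2π w f` on
each face `f`, and `w` jumps at an edge `e` by the signed number `n e` of its traversals
(`exists_winding`). Mod 2, the sum of `n e * c e` is therefore the sum over faces of `w f` times the
sum of `c` around `f`, which is zero. The same jump, applied to the boundary triangle of a face,
shows that the two sides of an edge are different faces (`exists_faces`). -/

open Filter Topology

/-! ### The angle subtended by a segment and its jump across the midpoint -/

/-- The oriented angle under which the segment from `a` to `b` is seen from `z`. -/
noncomputable def viewAngle (a b z : ℂ) : ℝ := ((b - z) / (a - z)).arg

theorem div_mem_slitPlane_of_notMem_segment {a b z : ℂ} (h : z ∉ segment ℝ a b) :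
    (b - z) / (a - z) ∈ Complex.slitPlane := by
  have ha : a - z ≠ 0 := fun h0 => h (by rw [← sub_eq_zero.1 h0]; exact left_mem_segment ℝ a b)
  rw [Complex.mem_slitPlane_iff]
  by_contra! hc
  obtain ⟨hre, him⟩ := hc
  set w := (b - z) / (a - z) with hw
  have hwre : w = ((w.re : ℝ) : ℂ) := Complex.ext (by simp) (by simp [him])
  have hb : b - z = (w.re : ℂ) * (a - z) := by
    rw [← hwre, hw]; field_simp
  apply h
  have h1 : 0 < 1 - w.re := by linarith
  -- If `b - z = r (a - z)` with `r ≤ 0`, solving for `z` gives these convex weights.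
  refine ⟨-w.re / (1 - w.re), 1 / (1 - w.re), div_nonneg (by linarith) h1.le,
    div_nonneg zero_le_one h1.le, ?_, ?_⟩
  · field_simp; ring
  · have h2 : (1 - (w.re : ℂ)) ≠ 0 := by exact_mod_cast h1.ne'
    simp only [Complex.real_smul]
    push_cast
    field_simp
    linear_combination hb

theorem continuousAt_viewAngle {a b z : ℂ} (h : z ∉ segment ℝ a b) :
    ContinuousAt (viewAngle a b) z := by
  have ha : a - z ≠ 0 := fun h0 => h (by rw [← sub_eq_zero.1 h0]; exact left_mem_segment ℝ a b)
  refine ContinuousAt.comp (f := fun z => (b - z) / (a - z)) (g := Complex.arg)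
    (Complex.continuousAt_arg (div_mem_slitPlane_of_notMem_segment h)) ?_
  exact (continuousAt_const.sub continuousAt_id).div (continuousAt_const.sub continuousAt_id) ha

theorem coe_viewAngle {a b z : ℂ} (ha : z ≠ a) (hb : z ≠ b) :
    (viewAngle a b z : Real.Angle) = (b - z).arg - (a - z).arg :=
  Complex.arg_div_coe_angle (sub_ne_zero.2 hb.symm) (sub_ne_zero.2 ha.symm)

/-- The signed distance, in units of the length of `b - a`, of `z` from the line through `a` and
`b`. -/
noncomputable def lineSide (a b z : ℂ) : ℝ := ((z - midpoint ℝ a b) / (b - a)).im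

theorem midpoint_eq_complex (a b : ℂ) : midpoint ℝ a b = (a + b) / 2 := by
  rw [midpoint_eq_smul_add, Complex.real_smul]
  simp only [invOf_eq_inv]
  push_cast
  ring

/-- The side of the line on which `z` lies decides from which side of the branch cut of `arg` the
quotient is seen. -/
theorem im_div_eq_lineSide {a b : ℂ} (hab : a ≠ b) (z : ℂ) :
    ((b - z) / (a - z)).im = lineSide a b z * (Complex.normSq ((b - a) / (a - z))) := by
  have hba : b - a ≠ 0 := sub_ne_zero.2 hab.symm
  rcases eq_or_ne z a with rfl | hz
  · simp
  have hz' : a - z ≠ 0 := sub_ne_zero.2 hz.symm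
  unfold lineSide
  rw [midpoint_eq_complex]
  have h1 : (z - (a + b) / 2) / (b - a) = -(((a - z) / (b - a)) + 1 / 2) := by field_simp; ring
  have h2 : (b - z) / (a - z) = 1 + ((a - z) / (b - a))⁻¹ := by field_simp; ring
  have h3 : (b - a) / (a - z) = ((a - z) / (b - a))⁻¹ := by rw [inv_div]
  rw [h1, h2, h3, map_inv₀]
  have h4 : Complex.normSq ((a - z) / (b - a)) ≠ 0 := by
    rw [Ne, Complex.normSq_eq_zero]; exact div_ne_zero hz' hba
  have h5 : ((1 : ℂ) / 2).im = 0 := by norm_num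
  rw [Complex.add_im, Complex.inv_im, Complex.neg_im, Complex.add_im, h5]
  simp only [Complex.one_im]
  field_simp
  ring

theorem div_midpoint {a b : ℂ} (hab : a ≠ b) :
    (b - midpoint ℝ a b) / (a - midpoint ℝ a b) = -1 := by
  have hba : a - b ≠ 0 := sub_ne_zero.2 hab
  rw [midpoint_eq_complex]
  have h : a - (a + b) / 2 = (a - b) / 2 := by ring
  rw [h]
  field_simp
  ring

theorem left_sub_midpoint_ne {a b : ℂ} (hab : a ≠ b) : a - midpoint ℝ a b ≠ 0 := by
  intro h
  have := div_midpoint hab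
  rw [h] at this
  simp at this

/-- At the midpoint the quotient is `-1`, on the branch cut of `arg`. The two sides of the segment
approach it from the two sides of the cut, whence the limits `π` and `-π`. -/
theorem tendsto_viewAngle_pos {a b : ℂ} (hab : a ≠ b) :
    Tendsto (viewAngle a b) (𝓝[{z | 0 < lineSide a b z}] (midpoint ℝ a b)) (𝓝 Real.pi) := by
  have h1 := Complex.tendsto_arg_nhdsWithin_im_nonneg_of_re_neg_of_im_zero
    (z := (-1 : ℂ)) (by simp) (by simp)
  refine h1.comp (tendsto_nhdsWithin_iff.2 ⟨?_, ?_⟩)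
  · rw [← div_midpoint hab]
    refine tendsto_nhdsWithin_of_tendsto_nhds ?_
    exact (continuousAt_const.sub continuousAt_id).div (continuousAt_const.sub continuousAt_id)
      (left_sub_midpoint_ne hab)
  · filter_upwards [self_mem_nhdsWithin] with z hz
    rw [im_div_eq_lineSide hab]
    exact mul_nonneg (le_of_lt hz) (Complex.normSq_nonneg _)

theorem tendsto_viewAngle_neg {a b : ℂ} (hab : a ≠ b) :
    Tendsto (viewAngle a b) (𝓝[{z | lineSide a b z < 0}] (midpoint ℝ a b)) (𝓝 (-Real.pi)) := by
  have h1 := Complex.tendsto_arg_nhdsWithin_im_neg_of_re_neg_of_im_zero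
    (z := (-1 : ℂ)) (by simp) (by simp)
  refine h1.comp (tendsto_nhdsWithin_iff.2 ⟨?_, ?_⟩)
  · rw [← div_midpoint hab]
    refine tendsto_nhdsWithin_of_tendsto_nhds ?_
    exact (continuousAt_const.sub continuousAt_id).div (continuousAt_const.sub continuousAt_id)
      (left_sub_midpoint_ne hab)
  · filter_upwards [self_mem_nhdsWithin] with z hz
    rw [im_div_eq_lineSide hab]
    -- Strictness matters, as `arg` equals `π` on the cut itself; so `z = a` has to be excluded.
    refine mul_neg_of_neg_of_pos hz (Complex.normSq_pos.2 (div_ne_zero (sub_ne_zero.2 hab.symm) ?_))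
    intro h0
    have hz' : lineSide a b z < 0 := hz
    rw [← sub_eq_zero.1 h0] at hz'
    have : lineSide a b a = 0 := by
      have hba : b - a ≠ 0 := sub_ne_zero.2 hab.symm
      unfold lineSide
      rw [midpoint_eq_complex]
      have : (a - (a + b) / 2) / (b - a) = -1 / 2 := by field_simp; ring
      rw [this]; norm_num
    linarith

theorem midpoint_add_mem_lineSide {a b : ℂ} (hab : a ≠ b) (t : ℝ) :
    lineSide a b (midpoint ℝ a b + t * (b - a) * Complex.I) = t := by
  have hba : b - a ≠ 0 := sub_ne_zero.2 hab.symm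
  unfold lineSide
  have : (midpoint ℝ a b + t * (b - a) * Complex.I - midpoint ℝ a b) / (b - a) = t * Complex.I := by
    field_simp; ring
  rw [this]; simp

theorem midpoint_mem_closure_of_lineSide {a b : ℂ} (hab : a ≠ b) {σ : ℝ} (hσ : σ ≠ 0) :
    midpoint ℝ a b ∈ closure {z | 0 < σ * lineSide a b z} := by
  have h : Tendsto (fun t : ℝ => midpoint ℝ a b + ((σ * t : ℝ) : ℂ) * (b - a) * Complex.I)
      (𝓝[>] 0) (𝓝 (midpoint ℝ a b)) := by
    refine tendsto_nhdsWithin_of_tendsto_nhds ?_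
    have : Continuous
      (fun t : ℝ => midpoint ℝ a b + ((σ * t : ℝ) : ℂ) * (b - a) * Complex.I) := by fun_prop
    simpa using this.tendsto 0
  refine mem_closure_of_tendsto h ?_
  filter_upwards [self_mem_nhdsWithin] with t ht
  rw [midpoint_add_mem_lineSide hab]
  have := mul_self_pos.2 hσ
  have ht' : 0 < t := ht
  nlinarith [mul_pos this ht']

theorem lineSide_eq_zero_of_mem_segment {a b z : ℂ} (h : z ∈ segment ℝ a b) :
    lineSide a b z = 0 := by
  rw [segment_eq_image_lineMap] at h
  obtain ⟨t, -, rfl⟩ := h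
  rcases eq_or_ne a b with rfl | hab
  · simp [lineSide]
  have hba : b - a ≠ 0 := sub_ne_zero.2 hab.symm
  unfold lineSide
  have : (AffineMap.lineMap a b t - midpoint ℝ a b) / (b - a) = ((t - 1 / 2 : ℝ) : ℂ) := by
    rw [midpoint_eq_complex, AffineMap.lineMap_apply]
    simp only [vsub_eq_sub, vadd_eq_add, Complex.real_smul]
    push_cast
    field_simp; ring
  rw [this, Complex.ofReal_im]

theorem eventually_mem_segment_of_lineSide_eq_zero {a b : ℂ} (hab : a ≠ b) :
    ∀ᶠ z in 𝓝 (midpoint ℝ a b), lineSide a b z = 0 → z ∈ segment ℝ a b := by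
  have hba : b - a ≠ 0 := sub_ne_zero.2 hab.symm
  have hc : Continuous fun z => ‖(z - midpoint ℝ a b) / (b - a)‖ :=
    ((continuous_id.sub continuous_const).div_const _).norm
  -- Within half the length of the segment from its midpoint, line and segment coincide.
  have h : ∀ᶠ z in 𝓝 (midpoint ℝ a b), ‖(z - midpoint ℝ a b) / (b - a)‖ < 1 / 2 :=
    hc.continuousAt.eventually_lt continuousAt_const (by simp)
  filter_upwards [h] with z hz h0
  set w := (z - midpoint ℝ a b) / (b - a) with hw
  have hwr : w = (w.re : ℂ) := Complex.ext (by simp) h0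
  have habs : |w.re| < 1 / 2 := lt_of_le_of_lt (Complex.abs_re_le_norm w) hz
  rw [abs_lt] at habs
  rw [segment_eq_image_lineMap]
  refine ⟨w.re + 1 / 2, ⟨by linarith, by linarith⟩, ?_⟩
  rw [AffineMap.lineMap_apply]
  simp only [vsub_eq_sub, vadd_eq_add, Complex.real_smul]
  push_cast
  rw [← hwr, hw, midpoint_eq_complex]
  field_simp
  ring

theorem convex_lineSide_pos (a b : ℂ) (σ : ℝ) : Convex ℝ {z | 0 < σ * lineSide a b z} := by
  have : {z | 0 < σ * lineSide a b z} =
      {z : ℂ | σ * (midpoint ℝ a b / (b - a)).im <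
        (σ • (Complex.imLm ∘ₗ (LinearMap.mulLeft ℝ ((b - a)⁻¹)))) z} := by
    ext z
    simp only [mem_ofPred_eq, lineSide, sub_div, Complex.sub_im]
    have : (σ • (Complex.imLm ∘ₗ (LinearMap.mulLeft ℝ ((b - a)⁻¹)))) z = σ * (z / (b - a)).im := by
      simp [div_eq_inv_mul]
    rw [this, mul_sub, sub_pos]
  rw [this]
  exact convex_halfSpace_gt (LinearMap.isLinear _) _

/-- A continuous function on a preconnected set with values in `2πℤ` is constant. -/
theorem IsPreconnected.eq_of_coe_angle_eq_zero {s : Set ℂ} (hs : IsPreconnected s) {θ : ℂ → ℝ}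
    (hc : ContinuousOn θ s) (h0 : ∀ z ∈ s, (θ z : Real.Angle) = 0) {x y : ℂ} (hx : x ∈ s)
    (hy : y ∈ s) : θ x = θ y := by
  have : DiscreteTopology (AddSubgroup.zmultiples (2 * Real.pi) : Set ℝ) :=
    inferInstanceAs (DiscreteTopology (AddSubgroup.zmultiples (2 * Real.pi)))
  refine hs.constant_of_mapsTo (T := (AddSubgroup.zmultiples (2 * Real.pi) : Set ℝ)) ⟨this⟩ hc ?_ hx hy
  intro z hz
  obtain ⟨n, hn⟩ := Real.Angle.coe_eq_zero_iff.1 (h0 z hz)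
  exact ⟨n, hn⟩

/-! ### Polygonal curves as unions of segments -/

theorem polyline_natCast_add (q : ℕ → ℂ) (i : ℕ) {t : ℝ} (h0 : 0 ≤ t) (h1 : t ≤ 1) :
    polyline q (i + t) = AffineMap.lineMap (q i) (q (i + 1)) t := by
  unfold polyline
  rcases h1.lt_or_eq with h | rfl
  · have : ⌊(i : ℝ) + t⌋₊ = i := by
      rw [Nat.floor_eq_iff (by positivity)]
      constructor <;> linarith
    rw [this, add_sub_cancel_left]
  -- The floor has moved on to the next segment, which starts at the same corner.
  · have : ⌊(i : ℝ) + 1⌋₊ = i + 1 := by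
      rw [Nat.floor_eq_iff (by positivity)]
      constructor <;> push_cast <;> linarith
    rw [this]
    push_cast
    simp

theorem polyline_natCast (q : ℕ → ℂ) (i : ℕ) : polyline q i = q i := by
  simpa using polyline_natCast_add q i le_rfl zero_le_one

theorem polyline_image_Icc (q : ℕ → ℂ) {n : ℕ} (hn : 0 < n) :
    polyline q '' Icc 0 (n : ℝ) = ⋃ i ∈ Finset.range n, segment ℝ (q i) (q (i + 1)) := by
  ext z
  simp only [mem_image, mem_iUnion, Finset.mem_range, exists_prop, segment_eq_image_lineMap]
  constructor
  · rintro ⟨t, ⟨h0, h1⟩, rfl⟩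
    rcases h1.lt_or_eq with h | rfl
    · refine ⟨⌊t⌋₊, (Nat.floor_lt h0).2 h, t - ⌊t⌋₊, ⟨?_, ?_⟩, rfl⟩
      · linarith [Nat.floor_le h0]
      · linarith [Nat.lt_floor_add_one t]
    · obtain ⟨m, rfl⟩ := Nat.exists_eq_succ_of_ne_zero hn.ne'
      refine ⟨m, Nat.lt_succ_self m, 1, by simp, ?_⟩
      rw [polyline_natCast]
      simp
  · rintro ⟨i, hi, t, ⟨h0, h1⟩, rfl⟩
    refine ⟨i + t, ⟨by positivity, ?_⟩, polyline_natCast_add q i h0 h1⟩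
    have : (i : ℝ) + 1 ≤ n := by exact_mod_cast hi
    linarith

/-! ### The drawing and its faces near the middle of a first segment -/

namespace PlaneEmbedding

variable {α β : Type*} {G : Graph α β}

/-- The midpoint of the first segment of the arc of `e`. -/
noncomputable def mid (D : PlaneEmbedding G) (e : β) : ℂ :=
  midpoint ℝ (D.corner e 0) (D.corner e 1)

/-- The position of a point relative to the line that carries the first segment of the arc
of `e`. -/
noncomputable def height (D : PlaneEmbedding G) (e : β) (z : ℂ) : ℝ :=
  lineSide (D.corner e 0) (D.corner e 1) z

/-- The total angle under which the arc of `e` is seen from `z`. -/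
noncomputable def turn (D : PlaneEmbedding G) (e : β) (z : ℂ) : ℝ :=
  ∑ i ∈ Finset.range (D.len e), viewAngle (D.corner e i) (D.corner e (i + 1)) z

variable (D : PlaneEmbedding G) {e e' : β}

theorem arc_eq_iUnion (he : e ∈ E(G)) :
    D.arc e = ⋃ i ∈ Finset.range (D.len e), segment ℝ (D.corner e i) (D.corner e (i + 1)) :=
  polyline_image_Icc _ (D.len_pos e he)

theorem isClosed_iUnion_segment (q : ℕ → ℂ) (s : Finset ℕ) :
    IsClosed (⋃ i ∈ s, segment ℝ (q i) (q (i + 1))) := by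
  refine s.finite_toSet.isClosed_biUnion fun i _ => ?_
  rw [segment_eq_image_lineMap]
  exact (isCompact_Icc.image (by fun_prop)).isClosed

theorem isClosed_arc (he : e ∈ E(G)) : IsClosed (D.arc e) := by
  rw [D.arc_eq_iUnion he]
  exact isClosed_iUnion_segment _ _

theorem arc_subset_support (he : e ∈ E(G)) : D.arc e ⊆ D.support :=
  fun _ hz => Or.inr (mem_biUnion he hz)

theorem corner_mem_arc {i : ℕ} (hi : i ≤ D.len e) : D.corner e i ∈ D.arc e :=
  ⟨i, ⟨by positivity, by exact_mod_cast hi⟩, polyline_natCast _ _⟩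

theorem one_le_len {e : β} (he : e ∈ E(G)) : (1 : ℝ) ≤ D.len e := by exact_mod_cast D.len_pos e he

theorem corner_zero_ne_one (he : e ∈ E(G)) : D.corner e 0 ≠ D.corner e 1 := by
  intro h
  have hl := D.one_le_len he
  have := D.simple e he (x₁ := (0 : ℕ)) (x₂ := (1 : ℕ))
    (mem_Icc.2 ⟨by simp, by simp⟩) (mem_Icc.2 ⟨by simp, by simpa using hl⟩) (by rw [polyline_natCast, polyline_natCast, h])
  simp at this

theorem polyline_half (e : β) : polyline (D.corner e) (1 / 2) = D.mid e := by
  have := polyline_natCast_add (D.corner e) 0 (t := 1 / 2) (by norm_num) (by norm_num)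
  rw [Nat.cast_zero, zero_add] at this
  rw [this, mid, midpoint]
  norm_num

theorem mid_mem_arc (he : e ∈ E(G)) : D.mid e ∈ D.arc e :=
  ⟨1 / 2, ⟨by norm_num, by linarith [D.one_le_len he]⟩, D.polyline_half e⟩

theorem mid_ne_pos (he : e ∈ E(G)) {v : α} (hv : v ∈ V(G)) : D.mid e ≠ D.pos v := by
  intro h
  refine D.vertex_notMem e he v hv ⟨1 / 2, ⟨by norm_num, by linarith [D.one_le_len he]⟩, ?_⟩
  rw [D.polyline_half, h]

theorem mid_notMem_arc (he : e ∈ E(G)) (he' : e' ∈ E(G)) (hne : e ≠ e') : D.mid e ∉ D.arc e' := by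
  rintro ⟨t, ⟨h0, h1⟩, ht⟩
  obtain ⟨u, v, huv, hu, hv⟩ := D.ends e' he'
  rcases h0.eq_or_lt with rfl | h0
  · have := polyline_natCast (D.corner e') 0
    rw [Nat.cast_zero] at this
    exact D.mid_ne_pos he huv.left_mem (by rw [← ht, this, hu])
  rcases h1.eq_or_lt with rfl | h1
  · exact D.mid_ne_pos he huv.right_mem (by rw [← ht, polyline_natCast, hv])
  · refine (Set.disjoint_left.1 (D.edge_disjoint e he e' he' hne)) (a := D.mid e)
      ⟨1 / 2, ⟨by norm_num, by linarith [D.one_le_len he]⟩, D.polyline_half e⟩ ⟨t, ⟨h0, h1⟩, ht⟩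

theorem mid_notMem_segment (he : e ∈ E(G)) {i : ℕ} (hi : i < D.len e) (h0 : i ≠ 0) :
    D.mid e ∉ segment ℝ (D.corner e i) (D.corner e (i + 1)) := by
  rw [segment_eq_image_lineMap]
  rintro ⟨t, ⟨ht0, ht1⟩, ht⟩
  rw [← polyline_natCast_add _ _ ht0 ht1, ← polyline_half] at ht
  have h1 : (i : ℝ) + 1 ≤ D.len e := by exact_mod_cast hi
  have h2 : (1 : ℝ) ≤ i := by exact_mod_cast Nat.one_le_iff_ne_zero.2 h0
  have := D.simple e he ⟨by positivity, by linarith⟩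
    ⟨by norm_num, by linarith [D.one_le_len he]⟩ ht
  linarith

/-- Near `D.mid e` the drawing is a straight line. -/
theorem eventually_mem_support_iff (hV : V(G).Finite) (hE : E(G).Finite) (he : e ∈ E(G)) :
    ∀ᶠ z in 𝓝 (D.mid e), z ∈ D.support ↔ D.height e z = 0 := by
  -- Vertices, other arcs and later segments of `e` form closed sets that miss `D.mid e`; near it
  -- only the first segment is left.
  have h1 : ∀ᶠ z in 𝓝 (D.mid e), z ∉ D.pos '' V(G) := by
    refine (hV.image _).isClosed.isOpen_compl.mem_nhds ?_
    rintro ⟨v, hv, h⟩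
    exact D.mid_ne_pos he hv h.symm
  have h2 : ∀ᶠ z in 𝓝 (D.mid e), z ∉ ⋃ e' ∈ E(G) \ {e}, D.arc e' := by
    refine (hE.sdiff.isClosed_biUnion fun e' he' =>
      D.isClosed_arc he'.1).isOpen_compl.mem_nhds ?_
    simp only [mem_compl_iff, mem_iUnion, not_exists]
    intro e' he'
    exact D.mid_notMem_arc he he'.1 fun h => he'.2 h.symm
  have h3 : ∀ᶠ z in 𝓝 (D.mid e), z ∉ ⋃ i ∈ (Finset.range (D.len e)).erase 0,
      segment ℝ (D.corner e i) (D.corner e (i + 1)) := by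
    refine (isClosed_iUnion_segment _ _).isOpen_compl.mem_nhds ?_
    simp only [mem_compl_iff, mem_iUnion, not_exists]
    intro i hi
    rw [Finset.mem_erase, Finset.mem_range] at hi
    exact D.mid_notMem_segment he hi.2 hi.1
  have h4 := eventually_mem_segment_of_lineSide_eq_zero (D.corner_zero_ne_one he)
  filter_upwards [h1, h2, h3, h4] with z hz1 hz2 hz3 hz4
  have hseg : z ∈ segment ℝ (D.corner e 0) (D.corner e 1) ↔ D.height e z = 0 :=
    ⟨lineSide_eq_zero_of_mem_segment, hz4⟩
  rw [← hseg]
  constructor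
  · rintro (h | h)
    · exact absurd h hz1
    simp only [mem_iUnion] at h hz2
    obtain ⟨e', he', h⟩ := h
    rcases eq_or_ne e' e with rfl | hne
    · rw [D.arc_eq_iUnion he'] at h
      simp only [mem_iUnion] at h hz3
      obtain ⟨i, hi, h⟩ := h
      rcases Nat.eq_zero_or_pos i with rfl | hi0
      · exact h
      · exact absurd ⟨i, Finset.mem_erase.2 ⟨hi0.ne', hi⟩, h⟩ hz3
    · exact absurd ⟨e', ⟨he', hne⟩, h⟩ hz2
  · intro h
    refine D.arc_subset_support he ?_
    rw [D.arc_eq_iUnion he]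
    simp only [mem_iUnion]
    exact ⟨0, Finset.mem_range.2 (D.len_pos e he), h⟩

/-- The faces on the two sides of `e` near `D.mid e`. -/
theorem exists_sideFaces (hV : V(G).Finite) (hE : E(G).Finite) (he : e ∈ E(G)) :
    ∃ f₁ f₂ : D.Face, f₁.1 ∈ 𝓝[{z | 0 < 1 * D.height e z}] (D.mid e) ∧
      f₂.1 ∈ 𝓝[{z | 0 < -1 * D.height e z}] (D.mid e) ∧
      ∀ f : D.Face, D.mid e ∈ closure f.1 → f = f₁ ∨ f = f₂ := by
  obtain ⟨r, hr, hball⟩ := Metric.eventually_nhds_iff_ball.1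
    (D.eventually_mem_support_iff hV hE he)
  -- The sign of `σ` selects a side. The half-disc `H` on that side is convex and misses the
  -- drawing, so it lies in a single face.
  have key : ∀ σ : ℝ, σ ≠ 0 → ∃ f : D.Face,
      f.1 ∈ 𝓝[{z | 0 < σ * D.height e z}] (D.mid e) ∧
      ∀ g : D.Face, ∀ z ∈ g.1, z ∈ Metric.ball (D.mid e) r → 0 < σ * D.height e z → g = f := by
    intro σ hσ
    obtain ⟨z, hz, hd⟩ := Metric.mem_closure_iff.1
      (midpoint_mem_closure_of_lineSide (D.corner_zero_ne_one he) hσ) r hr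
    set H := {z | 0 < σ * D.height e z} ∩ Metric.ball (D.mid e) r with hH
    have hHs : H ⊆ D.supportᶜ := by
      rintro y ⟨hy', hy⟩ h
      rw [mem_ofPred_eq, (hball y hy).1 h] at hy'
      simp at hy'
    have hHp : IsPreconnected H :=
      ((convex_lineSide_pos _ _ σ).inter (convex_ball _ _)).isPreconnected
    have hzH : z ∈ H := ⟨hz, by rw [Metric.mem_ball, dist_comm]; exact hd⟩
    have hsub := hHp.subset_connectedComponentIn hzH hHs
    refine ⟨⟨connectedComponentIn D.supportᶜ z, z, hHs hzH, rfl⟩,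
      mem_of_superset (inter_mem_nhdsWithin _ (Metric.ball_mem_nhds _ hr)) hsub, ?_⟩
    rintro ⟨g, w, hw, rfl⟩ y hy hyb hyσ
    exact Subtype.ext ((connectedComponentIn_eq hy).trans
      (connectedComponentIn_eq (hsub ⟨hyσ, hyb⟩)).symm)
  obtain ⟨f₁, h₁, h₁'⟩ := key 1 one_ne_zero
  obtain ⟨f₂, h₂, h₂'⟩ := key (-1) (by norm_num)
  refine ⟨f₁, f₂, h₁, h₂, fun f hf => ?_⟩
  obtain ⟨z, hz, hd⟩ := Metric.mem_closure_iff.1 hf r hr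
  have hzb : z ∈ Metric.ball (D.mid e) r := by rw [Metric.mem_ball, dist_comm]; exact hd
  have hzs : z ∉ D.support := by
    obtain ⟨g, w, hw, rfl⟩ := f
    exact connectedComponentIn_subset _ _ hz
  have hz0 : D.height e z ≠ 0 := fun h => hzs ((hball z hzb).2 h)
  rcases lt_or_gt_of_ne hz0 with h | h
  · exact Or.inr (h₂' f z hz hzb (by simpa using h))
  · exact Or.inl (h₁' f z hz hzb (by simpa using h))

theorem mid_mem_closure_of_mem_nhdsWithin (he : e ∈ E(G)) {σ : ℝ} (hσ : σ ≠ 0) {s : Set ℂ}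
    (h : s ∈ 𝓝[{z | 0 < σ * D.height e z}] (D.mid e)) : D.mid e ∈ closure s := by
  have hc := midpoint_mem_closure_of_lineSide (D.corner_zero_ne_one he) hσ
  have : (𝓝[{z | 0 < σ * D.height e z}] (D.mid e)).NeBot := mem_closure_iff_nhdsWithin_neBot.1 hc
  exact mem_closure_of_frequently_of_tendsto (f := id) (Eventually.frequently h)
    (tendsto_id.mono_left nhdsWithin_le_nhds)

theorem face_disjoint_support (f : D.Face) : Disjoint f.1 D.support := by
  obtain ⟨g, w, hw, rfl⟩ := f
  exact disjoint_left.2 fun z hz => connectedComponentIn_subset _ _ hz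

theorem isPreconnected_face (f : D.Face) : IsPreconnected f.1 := by
  obtain ⟨g, w, hw, rfl⟩ := f
  exact isPreconnected_connectedComponentIn

/-! ### Winding numbers of combinations of edges -/

theorem continuousAt_turn {z : ℂ} (he : e ∈ E(G)) (hz : z ∉ D.arc e) :
    ContinuousAt (D.turn e) z := by
  unfold turn
  refine tendsto_finsetSum _ fun i hi => continuousAt_viewAngle fun h => hz ?_
  rw [D.arc_eq_iUnion he]
  exact mem_biUnion hi h

/-- Modulo `2π` the angles of the successive segments telescope. -/
theorem coe_turn {z : ℂ} (hz : z ∉ D.arc e) :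
    (D.turn e z : Real.Angle) =
      (D.corner e (D.len e) - z).arg - (D.corner e 0 - z).arg := by
  have h : ∀ n ≤ D.len e, ((∑ i ∈ Finset.range n,
      viewAngle (D.corner e i) (D.corner e (i + 1)) z : ℝ) : Real.Angle) =
      (D.corner e n - z).arg - (D.corner e 0 - z).arg := by
    intro n
    induction n with
    | zero => intro _; simp
    | succ n ih =>
      intro hn
      rw [Finset.sum_range_succ, Real.Angle.coe_add, ih (by omega), coe_viewAngle]
      · abel
      · rintro rfl
        exact hz (D.corner_mem_arc (by omega))
      · rintro rfl
        exact hz (D.corner_mem_arc hn)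
  exact h _ le_rfl

/-- The angle under which the arc of `e` is seen jumps by `2π` at `D.mid e`. -/
theorem exists_tendsto_turn (he : e ∈ E(G)) : ∃ l : ℝ,
    Tendsto (D.turn e) (𝓝[{z | 0 < 1 * D.height e z}] (D.mid e)) (𝓝 (l + Real.pi)) ∧
    Tendsto (D.turn e) (𝓝[{z | 0 < -1 * D.height e z}] (D.mid e)) (𝓝 (l - Real.pi)) := by
  have hne := D.corner_zero_ne_one he
  -- Only the first segment contains `D.mid e`; the other terms are continuous there.
  have hr : ContinuousAt (fun z => ∑ i ∈ (Finset.range (D.len e)).erase 0,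
      viewAngle (D.corner e i) (D.corner e (i + 1)) z) (D.mid e) := by
    refine tendsto_finsetSum _ fun i hi => continuousAt_viewAngle ?_
    rw [Finset.mem_erase, Finset.mem_range] at hi
    exact D.mid_notMem_segment he hi.2 hi.1
  have heq : D.turn e = fun z => (∑ i ∈ (Finset.range (D.len e)).erase 0,
      viewAngle (D.corner e i) (D.corner e (i + 1)) z) +
      viewAngle (D.corner e 0) (D.corner e 1) z := by
    funext z
    exact (Finset.sum_erase_add _ _ (Finset.mem_range.2 (D.len_pos e he))).symm
  have hr' := hr.tendsto
  refine ⟨∑ i ∈ (Finset.range (D.len e)).erase 0,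
      viewAngle (D.corner e i) (D.corner e (i + 1)) (D.mid e), ?_, ?_⟩
  · rw [heq]
    refine (hr'.mono_left nhdsWithin_le_nhds).add ?_
    simpa only [one_mul, height, mid] using tendsto_viewAngle_pos hne
  · rw [heq, sub_eq_add_neg]
    refine (hr'.mono_left nhdsWithin_le_nhds).add ?_
    simpa only [neg_one_mul, neg_pos, height, mid] using tendsto_viewAngle_neg hne

theorem face_nonempty (f : D.Face) : f.1.Nonempty := by
  obtain ⟨g, w, hw, rfl⟩ := f
  exact ⟨w, mem_connectedComponentIn hw⟩

/-- An integral combination of the angles under which the edges are seen, with values in `2πℤ`,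
is `2π` times an integer that depends only on the face, and its jump at the edge `e` is the
coefficient of `e`. -/
theorem exists_winding (hE : E(G).Finite) (n : β → ℤ)
    (hn : ∀ z ∉ D.support, ∑ e ∈ hE.toFinset, n e • (D.turn e z : Real.Angle) = 0) :
    ∃ w : D.Face → ℤ, ∀ e ∈ E(G), ∀ f₁ f₂ : D.Face,
      f₁.1 ∈ 𝓝[{z | 0 < 1 * D.height e z}] (D.mid e) →
      f₂.1 ∈ 𝓝[{z | 0 < -1 * D.height e z}] (D.mid e) → w f₁ - w f₂ = n e := by
  classical
  set θ : ℂ → ℝ := fun z => ∑ e ∈ hE.toFinset, n e • D.turn e z with hθ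
  have hcoe : ∀ z ∉ D.support, (θ z : Real.Angle) = 0 := by
    intro z hz
    rw [← hn z hz, hθ]
    have := map_sum Real.Angle.coeHom (fun e => n e • D.turn e z) hE.toFinset
    simpa only [map_zsmul, Real.Angle.coe_coeHom] using this
  have hcont : ∀ z ∉ D.support, ContinuousAt θ z := fun z hz =>
    tendsto_finsetSum _ fun e he => (D.continuousAt_turn (hE.mem_toFinset.1 he)
      fun h => hz (D.arc_subset_support (hE.mem_toFinset.1 he) h)).const_smul (n e)
  have hw : ∀ f : D.Face, ∃ k : ℤ, ∀ z ∈ f.1, θ z = 2 * Real.pi * k := by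
    intro f
    have hf := disjoint_left.1 (D.face_disjoint_support f)
    obtain ⟨z, hz⟩ := D.face_nonempty f
    obtain ⟨k, hk⟩ := Real.Angle.coe_eq_zero_iff.1 (hcoe z (hf hz))
    refine ⟨k, fun y hy => ?_⟩
    rw [(D.isPreconnected_face f).eq_of_coe_angle_eq_zero
      (fun x hx => (hcont x (hf hx)).continuousWithinAt) (fun x hx => hcoe x (hf hx)) hy hz,
      ← hk, zsmul_eq_mul, mul_comm]
  choose w hw using hw
  refine ⟨w, fun e he f₁ f₂ h₁ h₂ => ?_⟩
  obtain ⟨l, hl₁, hl₂⟩ := D.exists_tendsto_turn he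
  have hsplit : θ = fun z => (∑ e' ∈ hE.toFinset.erase e, n e' • D.turn e' z) +
      n e • D.turn e z := by
    funext z
    exact (Finset.sum_erase_add _ _ (hE.mem_toFinset.2 he)).symm
  have hrest : Tendsto (fun z => ∑ e' ∈ hE.toFinset.erase e, n e' • D.turn e' z) (𝓝 (D.mid e))
      (𝓝 (∑ e' ∈ hE.toFinset.erase e, n e' • D.turn e' (D.mid e))) := by
    refine tendsto_finsetSum _ fun e' he' => ?_
    rw [Finset.mem_erase, hE.mem_toFinset] at he'
    exact (D.continuousAt_turn he'.2 (D.mid_notMem_arc he he'.2 he'.1.symm)).const_smul (n e')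
  -- `θ` is constant on `f`, so its one-sided limit at `D.mid e` is that constant. In the difference
  -- of the two sides all terms but that of `e` cancel.
  have key : ∀ (f : D.Face) (σ m : ℝ), σ ≠ 0 →
      f.1 ∈ 𝓝[{z | 0 < σ * D.height e z}] (D.mid e) →
      Tendsto (D.turn e) (𝓝[{z | 0 < σ * D.height e z}] (D.mid e)) (𝓝 m) →
      2 * Real.pi * w f =
        (∑ e' ∈ hE.toFinset.erase e, n e' • D.turn e' (D.mid e)) + n e • m := by
    intro f σ m hσ hf hm
    have hne : (𝓝[{z | 0 < σ * D.height e z}] (D.mid e)).NeBot :=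
      mem_closure_iff_nhdsWithin_neBot.1
        (midpoint_mem_closure_of_lineSide (D.corner_zero_ne_one he) hσ)
    have h1 := (hrest.mono_left (nhdsWithin_le_nhds (s := {z | 0 < σ * D.height e z}))).add
      (hm.const_smul (n e))
    rw [← hsplit] at h1
    refine tendsto_nhds_unique (Tendsto.congr' ?_ tendsto_const_nhds) h1
    filter_upwards [hf] with z hz using (hw f z hz).symm
  have k₁ := key f₁ 1 _ one_ne_zero h₁ hl₁
  have k₂ := key f₂ (-1) _ (by norm_num) h₂ hl₂
  simp only [zsmul_eq_mul] at k₁ k₂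
  have : 2 * Real.pi * ((w f₁ : ℝ) - w f₂) = 2 * Real.pi * n e := by linear_combination k₁ - k₂
  have := mul_left_cancel₀ Real.two_pi_pos.ne' this
  exact_mod_cast this

/-- The arc may be drawn from `u` to `v` or from `v` to `u`; `ε = ±1` corrects the direction. -/
theorem exists_sign_zsmul_turn {u v : α} (h : G.IsLink e u v) : ∃ ε : ℤ, ε ≠ 0 ∧ (ε : ZMod 2) = 1 ∧
    ∀ z ∉ D.support,
      ε • (D.turn e z : Real.Angle) = (D.pos v - z).arg - (D.pos u - z).arg := by
  obtain ⟨u', v', h', hu, hv⟩ := D.ends e h.edge_mem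
  have hcoe : ∀ z ∉ D.support,
      (D.turn e z : Real.Angle) = (D.pos v' - z).arg - (D.pos u' - z).arg := by
    intro z hz
    rw [D.coe_turn fun hz' => hz (D.arc_subset_support h.edge_mem hz'), hu, hv]
  rcases h.eq_and_eq_or_eq_and_eq h' with ⟨rfl, rfl⟩ | ⟨rfl, rfl⟩
  · exact ⟨1, one_ne_zero, by simp, fun z hz => by rw [one_zsmul, hcoe z hz]⟩
  · exact ⟨-1, by simp, by decide, fun z hz => by rw [neg_one_zsmul, hcoe z hz, neg_sub]⟩

/-! ### Incidence of faces and edges in a triangulated graph -/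

theorem edge_ne_of_isLink {a b : β} {u v w : α} (huv : u ≠ v) (hwu : w ≠ u) (ha : G.IsLink a u v)
    (hb : G.IsLink b v w) : a ≠ b := by
  rintro rfl
  rcases ha.eq_and_eq_or_eq_and_eq hb with ⟨h, -⟩ | ⟨h, -⟩
  · exact huv h
  · exact hwu h.symm

variable {D}

/-- The edges on the boundary of a face of a triangulated graph are the edges of a triangle. -/
theorem IsTriangulated.exists_triangle (hD : D.IsTriangulated) (f : D.Face) :
    ∃ u v w a b c, G.IsLink a u v ∧ G.IsLink b v w ∧ G.IsLink c w u ∧ a ≠ b ∧ b ≠ c ∧ c ≠ a ∧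
      (∀ e, D.Borders e f ↔ e = a ∨ e = b ∨ e = c) ∧
      ∀ e ∈ E(G), D.mid e ∈ frontier f.1 → D.Borders e f := by
  obtain ⟨u, v, w, a, b, c, huv, hvw, hwu, ha, hb, hc, hf⟩ := hD.2 f
  have h1 : ∀ e, (e = a ∨ e = b ∨ e = c) → D.Borders e f := by
    rintro e (rfl | rfl | rfl)
    · exact ⟨ha.edge_mem, by rw [hf]; exact fun z hz => Or.inl (Or.inl hz)⟩
    · exact ⟨hb.edge_mem, by rw [hf]; exact fun z hz => Or.inl (Or.inr hz)⟩
    · exact ⟨hc.edge_mem, by rw [hf]; exact fun z hz => Or.inr hz⟩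
  have h2 : ∀ e ∈ E(G), D.mid e ∈ frontier f.1 → e = a ∨ e = b ∨ e = c := by
    intro e he hm
    rw [hf] at hm
    by_contra! hne
    rcases hm with (hm | hm) | hm
    · exact D.mid_notMem_arc he ha.edge_mem hne.1 hm
    · exact D.mid_notMem_arc he hb.edge_mem hne.2.1 hm
    · exact D.mid_notMem_arc he hc.edge_mem hne.2.2 hm
  exact ⟨u, v, w, a, b, c, ha, hb, hc, edge_ne_of_isLink huv hwu ha hb,
    edge_ne_of_isLink hvw huv hb hc, edge_ne_of_isLink hwu hvw hc ha,
    fun e => ⟨fun h => h2 e h.1 (h.2 (D.mid_mem_arc h.1)), h1 e⟩, fun e he hm => h1 e (h2 e he hm)⟩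

/-- Each edge of a triangulated graph lies on the boundary of exactly two faces. -/
theorem IsTriangulated.exists_faces (hD : D.IsTriangulated) (hV : V(G).Finite) (hE : E(G).Finite)
    (he : e ∈ E(G)) : ∃ f₁ f₂ : D.Face, f₁ ≠ f₂ ∧ (∀ f, D.Borders e f ↔ f = f₁ ∨ f = f₂) ∧
      f₁.1 ∈ 𝓝[{z | 0 < 1 * D.height e z}] (D.mid e) ∧
      f₂.1 ∈ 𝓝[{z | 0 < -1 * D.height e z}] (D.mid e) := by
  classical
  obtain ⟨f₁, f₂, h₁, h₂, hf⟩ := D.exists_sideFaces hV hE he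
  have hb : ∀ (f : D.Face) (σ : ℝ), σ ≠ 0 →
      f.1 ∈ 𝓝[{z | 0 < σ * D.height e z}] (D.mid e) → D.Borders e f := by
    intro f σ hσ h
    obtain ⟨u, v, w, a, b, c, -, -, -, -, -, -, -, hfr⟩ := hD.exists_triangle f
    refine hfr e he ⟨D.mid_mem_closure_of_mem_nhdsWithin he hσ h, fun hi => ?_⟩
    exact disjoint_left.1 (D.face_disjoint_support f) (interior_subset hi)
      (D.arc_subset_support he (D.mid_mem_arc he))
  have hb₁ := hb f₁ 1 one_ne_zero h₁
  have hb₂ := hb f₂ (-1) (by norm_num) h₂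
  refine ⟨f₁, f₂, ?_, fun f => ⟨fun h => hf f (frontier_subset_closure
    (h.2 (D.mid_mem_arc he))), ?_⟩, h₁, h₂⟩
  -- The boundary triangle of `f₁` is a closed walk containing `e`, so its winding number jumps at
  -- `e` by a nonzero amount. Were both sides the same face, the jump would be zero.
  · obtain ⟨u, v, w, a, b, c, ha, hb, hc, hab, hbc, hca, hfe, -⟩ := hD.exists_triangle f₁
    obtain ⟨εa, ha0, -, hεa⟩ := D.exists_sign_zsmul_turn ha
    obtain ⟨εb, hb0, -, hεb⟩ := D.exists_sign_zsmul_turn hb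
    obtain ⟨εc, hc0, -, hεc⟩ := D.exists_sign_zsmul_turn hc
    obtain ⟨k, hk⟩ := D.exists_winding hE (Pi.single a εa + Pi.single b εb + Pi.single c εc) (by
      intro z hz
      simp only [Pi.add_apply, add_smul, Finset.sum_add_distrib, Pi.single_apply, ite_smul,
        zero_smul, Finset.sum_ite_eq', hE.mem_toFinset, ha.edge_mem, hb.edge_mem, hc.edge_mem,
        if_true, hεa z hz, hεb z hz, hεc z hz]
      abel)
    rintro rfl
    have := hk e he f₁ f₁ h₁ h₂
    rcases (hfe e).1 hb₁ with rfl | rfl | rfl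
    · simp [hab, hca.symm, ha0, eq_comm] at this
    · simp [hab.symm, hbc, hb0, eq_comm] at this
    · simp [hca, hbc.symm, hc0, eq_comm] at this
  · rintro (rfl | rfl) <;> assumption

theorem IsTriangulated.finite_face (hD : D.IsTriangulated) (hV : V(G).Finite)
    (hE : E(G).Finite) : Finite D.Face := by
  have : (⋃ e ∈ E(G), {f | D.Borders e f}).Finite := by
    refine hE.biUnion fun e he => ?_
    obtain ⟨f₁, f₂, -, h, -⟩ := hD.exists_faces hV hE he
    exact (toFinite {f₁, f₂}).subset fun f hf => (h f).1 hf
  refine Set.finite_univ_iff.1 (this.subset fun f _ => ?_)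
  obtain ⟨u, v, w, a, b, c, ha, -, -, -, -, -, h, -⟩ := hD.exists_triangle f
  exact mem_biUnion ha.edge_mem ((h a).2 (Or.inl rfl))

/-! ### Face cocycles mod 2 are coboundaries -/

variable (D) in
open Classical in
/-- A function on the edges, with values in `ZMod 2`, whose sum over the boundary of each face
vanishes. -/
def IsFaceCocycle (hE : E(G).Finite) (c : β → ZMod 2) : Prop :=
  ∀ f : D.Face, ∑ e ∈ hE.toFinset with D.Borders e f, c e = 0

theorem sum_borders_eq {M : Type*} [AddCommMonoid M] (hE : E(G).Finite) {f : D.Face} {a b c : β}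
    (hab : a ≠ b) (hbc : b ≠ c) (hca : c ≠ a) (h : ∀ e, D.Borders e f ↔ e = a ∨ e = b ∨ e = c)
    (g : β → M) [DecidablePred fun e => D.Borders e f] :
    ∑ e ∈ hE.toFinset with D.Borders e f, g e = g a + g b + g c := by
  classical
  have : ({e ∈ hE.toFinset | D.Borders e f} : Finset β) = {a, b, c} := by
    ext e
    simp only [Finset.mem_filter, hE.mem_toFinset, Finset.mem_insert, Finset.mem_singleton, ← h]
    exact ⟨fun h => h.2, fun h => ⟨h.1, h⟩⟩
  rw [this, Finset.sum_insert (by simp [hab, hca.symm]), Finset.sum_insert (by simp [hbc]),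
    Finset.sum_singleton, add_assoc]

/-- Modulo 2, `n e` is the sum of the winding numbers of the two faces at `e`. Exchanging the sums
over edges and faces leaves multiples of the sums of `c` around faces. -/
theorem IsTriangulated.sum_mul_eq_zero (hD : D.IsTriangulated) (hV : V(G).Finite)
    (hE : E(G).Finite) {c : β → ZMod 2} (hc : D.IsFaceCocycle hE c) (n : β → ℤ)
    (hn : ∀ z ∉ D.support, ∑ e ∈ hE.toFinset, n e • (D.turn e z : Real.Angle) = 0) :
    ∑ e ∈ hE.toFinset, (n e : ZMod 2) * c e = 0 := by
  classical
  obtain ⟨w, hw⟩ := D.exists_winding hE n hn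
  have := hD.finite_face hV hE
  have := Fintype.ofFinite D.Face
  have h1 : ∀ e ∈ hE.toFinset, (n e : ZMod 2) * c e =
      ∑ f : D.Face, if D.Borders e f then (w f : ZMod 2) * c e else 0 := by
    intro e he
    rw [hE.mem_toFinset] at he
    obtain ⟨f₁, f₂, hne, hf, h₁, h₂⟩ := hD.exists_faces hV hE he
    have hfil : (Finset.univ.filter fun f => D.Borders e f) = {f₁, f₂} := by
      ext f; simp [hf]
    rw [← Finset.sum_filter, hfil, Finset.sum_pair hne, ← hw e he f₁ f₂ h₁ h₂, Int.cast_sub,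
      CharTwo.sub_eq_add, add_mul]
  rw [Finset.sum_congr rfl h1, Finset.sum_comm]
  refine Finset.sum_eq_zero fun f _ => ?_
  rw [← Finset.sum_filter, ← Finset.mul_sum, hc f, mul_zero]

/-- On a triangulated plane graph a face cocycle is a coboundary. -/
theorem IsTriangulated.exists_coboundary (hD : D.IsTriangulated) (hV : V(G).Finite)
    (hE : E(G).Finite) {c : β → ZMod 2} (hc : D.IsFaceCocycle hE c) (v₁ : V(G)) :
    ∃ X : V(G) → ZMod 2, ∀ e (u v : V(G)), G.IsLink e u v → X v = X u + c e := by
  classical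
  -- Walks that carry the running sum of `c`; `X v` will be the sum reached at `v`, well defined by
  -- `huniq`.
  let R : α × ZMod 2 → α × ZMod 2 → Prop := fun p q => ∃ e, G.IsLink e p.1 q.1 ∧ q.2 = p.2 + c e
  -- `n` is the signed edge count of the walk. Its angle telescopes to the two ends, so the counts
  -- of two walks with the same ends differ by a combination of angle zero.
  have hinv : ∀ p, Relation.ReflTransGen R (v₁, 0) p → ∃ n : β → ℤ,
      (∀ z ∉ D.support, ∑ e ∈ hE.toFinset, n e • (D.turn e z : Real.Angle) =
        (D.pos p.1 - z).arg - (D.pos v₁ - z).arg) ∧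
      ∑ e ∈ hE.toFinset, (n e : ZMod 2) * c e = p.2 := by
    intro p hp
    induction hp with
    | refl => exact ⟨0, by simp, by simp⟩
    | @tail p q _ hpq ih =>
      obtain ⟨n, hn, hs⟩ := ih
      obtain ⟨e, he, hq⟩ := hpq
      obtain ⟨ε, -, hε, hε'⟩ := D.exists_sign_zsmul_turn he
      refine ⟨n + Pi.single e ε, fun z hz => ?_, ?_⟩
      · simp only [Pi.add_apply, add_smul, Finset.sum_add_distrib, Pi.single_apply, ite_smul,
          zero_smul, Finset.sum_ite_eq', hE.mem_toFinset, he.edge_mem, if_true, hε' z hz, hn z hz]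
        abel
      · rw [hq, ← hs]
        simp only [Pi.add_apply, Int.cast_add, add_mul, Finset.sum_add_distrib, Pi.single_apply,
          Int.cast_ite, Int.cast_zero, ite_mul, zero_mul, Finset.sum_ite_eq', hE.mem_toFinset,
          he.edge_mem, if_true, hε, one_mul]
  have huniq : ∀ v s t, Relation.ReflTransGen R (v₁, 0) (v, s) →
      Relation.ReflTransGen R (v₁, 0) (v, t) → s = t := by
    intro v s t hs ht
    obtain ⟨m, hm, hms⟩ := hinv _ hs
    obtain ⟨n, hn, hnt⟩ := hinv _ ht
    have := hD.sum_mul_eq_zero hV hE hc (m - n) (fun z hz => by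
      simp only [Pi.sub_apply, sub_smul, Finset.sum_sub_distrib, hm z hz, hn z hz, sub_self])
    simp only [Pi.sub_apply, Int.cast_sub, sub_mul, Finset.sum_sub_distrib, hms, hnt] at this
    exact sub_eq_zero.1 this
  have hex : ∀ v : V(G), ∃ s, Relation.ReflTransGen R (v₁, 0) (v, s) := by
    intro v
    have h : ∀ w, Relation.ReflTransGen G.Adj v₁ w →
        ∃ s, Relation.ReflTransGen R (v₁, 0) (w, s) := by
      intro w hw
      induction hw with
      | refl => exact ⟨0, .refl⟩
      | tail _ hvw ih =>
        obtain ⟨s, hs⟩ := ih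
        obtain ⟨e, he⟩ := hvw
        exact ⟨s + c e, hs.tail ⟨e, he, rfl⟩⟩
    exact h v (hD.1.2.1 v₁ v₁.2 v v.2)
  choose X hX using hex
  exact ⟨X, fun e u v h => huniq v _ _ (hX v) ((hX u).tail ⟨e, h, rfl⟩)⟩

/-! ### Perfect matchings and the edge sets they cross -/

variable (D)
/-- The edges of `G*` that cross an edge in `S`, together with the edges inside the Fisher cities
whose two ends belong to edges outside `S`. -/
def completion (S : Set β) : D.expandedDual.Subgraph where
  verts := univ
  Adj x y := (x.face ≠ y.face ∧ x.edge = y.edge ∧ x.edge ∈ S) ∨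
    (x.face = y.face ∧ x.edge ≠ y.edge ∧ x.edge ∉ S ∧ y.edge ∉ S)
  adj_sub h := h.elim (fun h => Or.inr ⟨h.1, h.2.1⟩) (fun h => Or.inl ⟨h.1, h.2.1⟩)
  edge_vert _ := mem_univ _
  symm := ⟨by
    rintro x y (⟨h₁, h₂, h₃⟩ | ⟨h₁, h₂, h₃, h₄⟩)
    exacts [Or.inl ⟨h₁.symm, h₂.symm, h₂ ▸ h₃⟩, Or.inr ⟨h₁.symm, h₂.symm, h₄, h₃⟩]⟩

/-- The intercity edges that cross an edge in `S`. -/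
def crossing (S : Set β) : Set (Sym2 D.DualVertex) := {s | ∃ e ∈ S, D.Crosses s e}

/-- The edges that are crossed by an edge of `P`. -/
def crossed (P : D.expandedDual.Subgraph) : Set β :=
  {e | ∃ x y, P.Adj x y ∧ x.face ≠ y.face ∧ x.edge = e}

/-- The edges whose ends have equal spins. -/
def equalEdges (X : V(G) → ℤˣ) : Set β := {e | ∃ v w : V(G), G.IsLink e v w ∧ X v = X w}

theorem mk_mem_intercity {x y : D.DualVertex} :
    s(x, y) ∈ D.intercity ↔ x.face ≠ y.face ∧ x.edge = y.edge := by
  constructor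
  · rintro ⟨h, x', y', hs, hf⟩
    have hf' : x.face ≠ y.face := by
      rcases Sym2.eq_iff.1 hs with ⟨rfl, rfl⟩ | ⟨rfl, rfl⟩
      exacts [hf, hf.symm]
    exact ⟨hf', (h.resolve_left fun h => hf' h.1).2⟩
  · exact fun h => ⟨Or.inr h, x, y, rfl, h.1⟩

theorem mk_crosses {x y : D.DualVertex} :
    D.Crosses s(x, y) e ↔ x.face ≠ y.face ∧ x.edge = e ∧ y.edge = e := by
  unfold Crosses
  rw [mk_mem_intercity]
  simp only [Sym2.mem_iff, forall_eq_or_imp, forall_eq]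
  exact ⟨fun h => ⟨h.1.1, h.2⟩, fun h => ⟨⟨h.1, h.2.1.trans h.2.2.symm⟩, h.2⟩⟩

theorem equalSpin_eq_crossing (X : V(G) → ℤˣ) : D.equalSpin X = D.crossing (equalEdges X) := by
  ext s
  constructor
  · rintro ⟨e, v, w, hs, hl, h⟩
    exact ⟨e, ⟨v, w, hl, h⟩, hs⟩
  · rintro ⟨e, ⟨v, w, hl, h⟩, hs⟩
    exact ⟨e, v, w, hs, hl, h⟩

theorem completion_edgeSet_inter_intercity (S : Set β) :
    (D.completion S).edgeSet ∩ D.intercity = D.crossing S := by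
  ext s
  induction s with | _ x y
  simp only [mem_inter_iff, SimpleGraph.Subgraph.mem_edgeSet, mk_mem_intercity, completion,
    crossing, mem_ofPred_eq, mk_crosses]
  constructor
  · rintro ⟨h, hf, he⟩
    exact ⟨x.edge, (h.resolve_right fun h => hf h.1).2.2, hf, rfl, he.symm⟩
  · rintro ⟨e, heS, hf, rfl, he⟩
    exact ⟨Or.inl ⟨hf, he.symm, heS⟩, hf, he.symm⟩

theorem equalEdges_subset (X : V(G) → ℤˣ) : equalEdges X ⊆ E(G) := by
  rintro e ⟨v, w, h, -⟩
  exact h.edge_mem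

theorem mem_equalEdges_iff {X : V(G) → ℤˣ} {u v : V(G)} (h : G.IsLink e u v) :
    e ∈ equalEdges X ↔ X u = X v := by
  constructor
  · rintro ⟨u', v', h', hX⟩
    rcases h.eq_and_eq_or_eq_and_eq h' with ⟨h1, h2⟩ | ⟨h1, h2⟩
    · rwa [Subtype.ext h1, Subtype.ext h2]
    · rw [Subtype.ext h1, Subtype.ext h2, hX]
  · exact fun hX => ⟨u, v, h, hX⟩

theorem crossed_subset (P : D.expandedDual.Subgraph) : D.crossed P ⊆ E(G) := by
  rintro e ⟨x, y, -, -, rfl⟩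
  exact x.borders.1

variable {D}

/-- Every edge borders two distinct faces, hence is crossed by an intercity edge, which in turn
determines it. -/
theorem IsTriangulated.crossing_injOn (hD : D.IsTriangulated) (hV : V(G).Finite)
    (hE : E(G).Finite) {S T : Set β} (hS : S ⊆ E(G)) (h : D.crossing S ⊆ D.crossing T) :
    S ⊆ T := by
  intro e he
  obtain ⟨f₁, f₂, hne, hf, -⟩ := hD.exists_faces hV hE (hS he)
  obtain ⟨e', he', hs⟩ := h (a := s(⟨f₁, e, (hf f₁).2 (Or.inl rfl)⟩, ⟨f₂, e, (hf f₂).2 (Or.inr rfl)⟩))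
    ⟨e, he, (D.mk_crosses).2 ⟨hne, rfl, rfl⟩⟩
  obtain ⟨-, h1, -⟩ := (D.mk_crosses).1 hs
  have h2 : e = e' := h1
  exact h2 ▸ he'

/-- Only two faces border an edge, so a corner has at most one neighbour outside its city. -/
theorem IsTriangulated.face_eq (hD : D.IsTriangulated) (hV : V(G).Finite) (hE : E(G).Finite)
    {x y z : D.DualVertex} (hxy : x.face ≠ y.face) (hxz : x.face ≠ z.face)
    (hy : x.edge = y.edge) (hz : x.edge = z.edge) : y = z := by
  obtain ⟨f₁, f₂, -, hf, -⟩ := hD.exists_faces hV hE x.borders.1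
  have h1 := (hf _).1 x.borders
  have h2 := (hf y.face).1 (hy ▸ y.borders)
  have h3 := (hf z.face).1 (hz ▸ z.borders)
  refine DualVertex.ext ?_ (hy.symm.trans hz)
  rcases h1 with h1 | h1 <;> rcases h2 with h2 | h2 <;> rcases h3 with h3 | h3 <;> simp_all

theorem IsTriangulated.exists_neighbor (hD : D.IsTriangulated) (hV : V(G).Finite)
    (hE : E(G).Finite) (x : D.DualVertex) : ∃ y : D.DualVertex, x.face ≠ y.face ∧ x.edge = y.edge := by
  obtain ⟨f₁, f₂, hne, hf, -⟩ := hD.exists_faces hV hE x.borders.1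
  rcases (hf _).1 x.borders with h | h
  · exact ⟨⟨f₂, x.edge, (hf f₂).2 (Or.inr rfl)⟩, by rw [h]; exact hne, rfl⟩
  · exact ⟨⟨f₁, x.edge, (hf f₁).2 (Or.inl rfl)⟩, by rw [h]; exact hne.symm, rfl⟩

/-- The number of edges outside `S` on the boundary of each face is even. -/
def IsFaceEven (D : PlaneEmbedding G) (S : Set β) : Prop :=
  ∀ f : D.Face, ∀ a b c, a ≠ b → b ≠ c → c ≠ a → (∀ e, D.Borders e f ↔ e = a ∨ e = b ∨ e = c) →
    (a ∈ S ∧ b ∈ S ∧ c ∈ S) ∨ (a ∈ S ∧ b ∉ S ∧ c ∉ S) ∨ (a ∉ S ∧ b ∈ S ∧ c ∉ S) ∨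
      (a ∉ S ∧ b ∉ S ∧ c ∈ S)

/-- The Fisher city of a vertex of the expanded dual graph is a triangle. -/
theorem IsTriangulated.exists_city (hD : D.IsTriangulated) (x : D.DualVertex) :
    ∃ y z : D.DualVertex, x ≠ y ∧ y ≠ z ∧ z ≠ x ∧ x.edge ≠ y.edge ∧ y.edge ≠ z.edge ∧
      z.edge ≠ x.edge ∧ y.face = x.face ∧ z.face = x.face ∧
      (∀ t : D.DualVertex, t.face = x.face → t = x ∨ t = y ∨ t = z) ∧
      ∀ e, D.Borders e x.face ↔ e = x.edge ∨ e = y.edge ∨ e = z.edge := by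
  obtain ⟨-, -, -, a, b, c, -, -, -, hab, hbc, hca, h, -⟩ := hD.exists_triangle x.face
  have key : ∀ a b c, a ≠ b → b ≠ c → c ≠ a → (∀ e, D.Borders e x.face ↔ e = a ∨ e = b ∨ e = c) →
      x.edge = a → ∃ y z : D.DualVertex, x ≠ y ∧ y ≠ z ∧ z ≠ x ∧ x.edge ≠ y.edge ∧
      y.edge ≠ z.edge ∧ z.edge ≠ x.edge ∧ y.face = x.face ∧ z.face = x.face ∧
      (∀ t : D.DualVertex, t.face = x.face → t = x ∨ t = y ∨ t = z) ∧
      ∀ e, D.Borders e x.face ↔ e = x.edge ∨ e = y.edge ∨ e = z.edge := by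
    rintro a b c hab hbc hca h rfl
    have hne : ∀ {s t : D.DualVertex}, s.edge ≠ t.edge → s ≠ t := fun h h' => h (h' ▸ rfl)
    refine ⟨⟨x.face, b, (h b).2 (by simp)⟩, ⟨x.face, c, (h c).2 (by simp)⟩, hne hab, hne hbc,
      hne hca, hab, hbc, hca, rfl, rfl, fun t ht => ?_, h⟩
    rcases (h t.edge).1 (ht ▸ t.borders) with h | h | h
    · exact Or.inl (DualVertex.ext ht h)
    · exact Or.inr (Or.inl (DualVertex.ext ht h))
    · exact Or.inr (Or.inr (DualVertex.ext ht h))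
  rcases (h x.edge).1 x.borders with hx | hx | hx
  · exact key a b c hab hbc hca h hx
  · exact key b c a hbc hca hab (fun e => by rw [h]; tauto) hx
  · exact key c a b hca hab hbc (fun e => by rw [h]; tauto) hx

theorem IsTriangulated.isPerfectMatching_completion (hD : D.IsTriangulated) (hV : V(G).Finite)
    (hE : E(G).Finite) {S : Set β} (hS : D.IsFaceEven S) :
    (D.completion S).IsPerfectMatching := by
  refine ⟨fun x _ => ?_, fun x => mem_univ x⟩
  by_cases hx : x.edge ∈ S
  · obtain ⟨y, hf, he⟩ := hD.exists_neighbor hV hE x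
    refine ⟨y, Or.inl ⟨hf, he, hx⟩, ?_⟩
    rintro z (⟨hf', he', -⟩ | ⟨-, -, h, -⟩)
    · exact hD.face_eq hV hE hf' hf he' he
    · exact absurd hx h
  · obtain ⟨y, z, -, -, -, hxy, hyz, hzx, hfy, hfz, hcity, hb⟩ := hD.exists_city x
    -- By parity exactly one other corner of the city is outside `S`: here `y`, the only possible
    -- mate of `x`.
    have key : ∀ y z : D.DualVertex, y.face = x.face → x.edge ≠ y.edge → y.edge ∉ S → z.edge ∈ S →
        (∀ t : D.DualVertex, t.face = x.face → t = x ∨ t = y ∨ t = z) →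
        ∃! w, (D.completion S).Adj x w := by
      intro y z hfy hxy hy hz hcity
      refine ⟨y, Or.inr ⟨hfy.symm, hxy, hx, hy⟩, ?_⟩
      rintro t (⟨-, -, h⟩ | ⟨hf, he, -, ht⟩)
      · exact absurd h hx
      · rcases hcity t hf.symm with rfl | rfl | rfl
        · exact absurd rfl he
        · rfl
        · exact absurd hz ht
    rcases hS x.face _ _ _ hxy hyz hzx hb with h | h | h | h
    · exact absurd h.1 hx
    · exact absurd h.1 hx
    · exact key z y hfz hzx.symm h.2.2 h.2.1 fun t ht => by have := hcity t ht; tauto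
    · exact key y z hfy hxy h.2.1 h.2.2 hcity

theorem mem_crossed_of_adj {P : D.expandedDual.Subgraph} {x y : D.DualVertex} (h : P.Adj x y)
    (hf : x.face ≠ y.face) : x.edge ∈ D.crossed P :=
  ⟨x, y, h, hf, rfl⟩

theorem IsTriangulated.exists_adj_of_mem_crossed (hD : D.IsTriangulated) (hV : V(G).Finite)
    (hE : E(G).Finite) {P : D.expandedDual.Subgraph} {x : D.DualVertex}
    (h : x.edge ∈ D.crossed P) : ∃ y, P.Adj x y ∧ x.face ≠ y.face ∧ x.edge = y.edge := by
  obtain ⟨y, z, hyz, hf, he⟩ := h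
  have hez : y.edge = z.edge := ((P.adj_sub hyz).resolve_left fun h => hf h.1).2
  by_cases hxy : x.face = y.face
  · have : x = y := DualVertex.ext hxy he.symm
    exact this ▸ ⟨z, hyz, hf, hez⟩
  · by_cases hxz : x.face = z.face
    · have : x = z := DualVertex.ext hxz (he.symm.trans hez)
      exact this ▸ ⟨y, hyz.symm, hf.symm, hez.symm⟩
    · have : y = z := hD.face_eq hV hE hxy hxz he.symm (he.symm.trans hez)
      exact absurd (congrArg DualVertex.face this) hf

/-- In a perfect matching, a vertex not matched along an intercity edge is matched inside its
Fisher city. -/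
theorem exists_adj_of_notMem_crossed {P : D.expandedDual.Subgraph} (hP : P.IsPerfectMatching)
    {x : D.DualVertex} (h : x.edge ∉ D.crossed P) :
    ∃ y, P.Adj x y ∧ y.face = x.face ∧ x.edge ≠ y.edge := by
  obtain ⟨y, hy, -⟩ := hP.1 (hP.2 x)
  have hf : x.face = y.face := by
    by_contra hf
    exact h (mem_crossed_of_adj hy hf)
  exact ⟨y, hy, hf.symm, ((P.adj_sub hy).resolve_right fun h => h.1 hf).2⟩

theorem IsTriangulated.notMem_crossed_of_adj (hD : D.IsTriangulated) (hV : V(G).Finite)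
    (hE : E(G).Finite) {P : D.expandedDual.Subgraph} (hP : P.IsPerfectMatching)
    {x y : D.DualVertex} (h : P.Adj x y) (hf : x.face = y.face) : x.edge ∉ D.crossed P := by
  intro hx
  obtain ⟨z, hz, hfz, -⟩ := hD.exists_adj_of_mem_crossed hV hE hx
  exact hfz (hP.1.eq_of_adj_left hz h ▸ hf)

theorem IsTriangulated.adj_iff (hD : D.IsTriangulated) (hV : V(G).Finite)
    (hE : E(G).Finite) {P : D.expandedDual.Subgraph} (hP : P.IsPerfectMatching)
    (x y : D.DualVertex) : P.Adj x y ↔ (D.completion (D.crossed P)).Adj x y := by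
  constructor
  · intro h
    by_cases hf : x.face = y.face
    · exact Or.inr ⟨hf, ((P.adj_sub h).resolve_right fun h => h.1 hf).2,
        hD.notMem_crossed_of_adj hV hE hP h hf, hD.notMem_crossed_of_adj hV hE hP h.symm hf.symm⟩
    · exact Or.inl ⟨hf, ((P.adj_sub h).resolve_left fun h => hf h.1).2, mem_crossed_of_adj h hf⟩
  · rintro (⟨hf, he, hx⟩ | ⟨hf, he, hx, hy⟩)
    · obtain ⟨z, hz, hfz, hez⟩ := hD.exists_adj_of_mem_crossed hV hE hx
      rwa [hD.face_eq hV hE hf hfz he hez]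
    · obtain ⟨s, hs, hfs, hes⟩ := exists_adj_of_notMem_crossed hP hx
      obtain ⟨t, ht, hft, het⟩ := exists_adj_of_notMem_crossed hP hy
      obtain ⟨p, q, hxp, hpq, hqx, -, -, -, -, -, hcity, -⟩ := hD.exists_city x
      have hsx : s ≠ x := fun h => hes (h ▸ rfl)
      have hty : t ≠ y := fun h => het (h ▸ rfl)
      have hyx : y ≠ x := fun h => he (h ▸ rfl)
      -- If `x` and `y` were not mates, both would be matched to the third corner of the city.
      by_contra hxy
      have hsy : s ≠ y := fun h => hxy (h ▸ hs)
      have htx : t ≠ x := fun h => hxy (h ▸ ht.symm)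
      have hst : s ≠ t := fun h => hyx (hP.1.eq_of_adj_right ht (h ▸ hs))
      have h1 := hcity s hfs
      have h2 := hcity t (hft.trans hf.symm)
      have h3 := hcity y hf.symm
      grind

theorem IsTriangulated.eq_completion (hD : D.IsTriangulated) (hV : V(G).Finite)
    (hE : E(G).Finite) {P : D.expandedDual.Subgraph} (hP : P.IsPerfectMatching) :
    P = D.completion (D.crossed P) :=
  SimpleGraph.Subgraph.ext (eq_univ_of_forall hP.2)
    (by ext x y; exact hD.adj_iff hV hE hP x y)

theorem IsTriangulated.isFaceEven_crossed (hD : D.IsTriangulated) (hV : V(G).Finite)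
    (hE : E(G).Finite) {P : D.expandedDual.Subgraph} (hP : P.IsPerfectMatching) :
    D.IsFaceEven (D.crossed P) := by
  intro f a b c hab hbc hca h
  -- A single uncrossed corner has no possible mate in its city.
  have key : ∀ a b c, (∀ e, D.Borders e f ↔ e = a ∨ e = b ∨ e = c) →
      a ∉ D.crossed P → b ∈ D.crossed P → c ∈ D.crossed P → False := by
    intro a b c h ha hb hc
    obtain ⟨y, hy, hf, he⟩ := exists_adj_of_notMem_crossed hP
      (x := ⟨f, a, (h a).2 (Or.inl rfl)⟩) ha
    have hy' := hD.notMem_crossed_of_adj hV hE hP hy.symm hf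
    have hf' : y.face = f := hf
    rcases (h y.edge).1 (hf' ▸ y.borders) with h | h | h
    · exact he h.symm
    · exact hy' (h ▸ hb)
    · exact hy' (h ▸ hc)
  -- Three uncrossed corners cannot be paired among themselves.
  have key' : a ∉ D.crossed P → b ∉ D.crossed P → c ∉ D.crossed P → False := by
    intro ha hb hc
    have hmate : ∀ {e}, (he : D.Borders e f) → e ∉ D.crossed P → ∃ e', ∃ he' : D.Borders e' f,
        P.Adj ⟨f, e, he⟩ ⟨f, e', he'⟩ ∧ e ≠ e' := by
      intro e he hec
      obtain ⟨⟨f', e', he'⟩, hy, rfl, hne⟩ := exists_adj_of_notMem_crossed hP (x := ⟨f, e, he⟩) hec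
      exact ⟨e', he', hy, hne⟩
    have hinj : ∀ {e e' e''} (he : D.Borders e f) (he' : D.Borders e' f) (he'' : D.Borders e'' f),
        P.Adj ⟨f, e, he⟩ ⟨f, e', he'⟩ → P.Adj ⟨f, e, he⟩ ⟨f, e'', he''⟩ → e' = e'' :=
      fun _ _ _ h h' => congrArg DualVertex.edge (hP.1.eq_of_adj_left h h')
    obtain ⟨a', hba, hA, hna⟩ := hmate ((h a).2 (by simp)) ha
    obtain ⟨b', hbb, hB, hnb⟩ := hmate ((h b).2 (by simp)) hb
    obtain ⟨c', hbc', hC, hnc⟩ := hmate ((h c).2 (by simp)) hc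
    rcases (h a').1 hba with rfl | rfl | rfl
    · exact hna rfl
    · rcases (h c').1 hbc' with rfl | rfl | rfl
      · exact hbc (hinj _ _ _ hA hC.symm)
      · exact hca (hinj _ _ _ hC.symm hA.symm)
      · exact hnc rfl
    · rcases (h b').1 hbb with rfl | rfl | rfl
      · exact hbc (hinj _ _ _ hB.symm hA)
      · exact hnb rfl
      · exact hab (hinj _ _ _ hA.symm hB.symm)
  have k1 := key a b c h
  have k2 := key b c a (fun e => by rw [h]; tauto)
  have k3 := key c a b (fun e => by rw [h]; tauto)
  tauto

/-! ### Spin configurations and the edge sets of equal spins -/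

theorem IsTriangulated.isFaceEven_equalEdges (hD : D.IsTriangulated) (hE : E(G).Finite)
    (X : V(G) → ℤˣ) : D.IsFaceEven (equalEdges X) := by
  classical
  intro f a b c hab hbc hca h
  obtain ⟨u, v, w, a', b', c', ha, hb, hc, hab', hbc', hca', h', -⟩ := hD.exists_triangle f
  -- The triangle may list the boundary edges in another order than `a b c`; a sum over the boundary
  -- carries the parity over without matching the labels.
  have h0 : (equalEdges X).indicator (1 : β → ZMod 2) a' +
      (equalEdges X).indicator (1 : β → ZMod 2) b' +
      (equalEdges X).indicator (1 : β → ZMod 2) c' = 1 := by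
    have ha := mem_equalEdges_iff (X := X) (u := ⟨u, ha.left_mem⟩) (v := ⟨v, ha.right_mem⟩) ha
    have hb := mem_equalEdges_iff (X := X) (u := ⟨v, hb.left_mem⟩) (v := ⟨w, hb.right_mem⟩) hb
    have hc := mem_equalEdges_iff (X := X) (u := ⟨w, hc.left_mem⟩) (v := ⟨u, hc.right_mem⟩) hc
    simp only [indicator_apply, ha, hb, hc, Pi.one_apply]
    generalize X ⟨u, _⟩ = x
    generalize X ⟨v, _⟩ = y
    generalize X ⟨w, _⟩ = z
    revert x y z
    decide
  rw [← sum_borders_eq hE hab' hbc' hca' h', sum_borders_eq hE hab hbc hca h] at h0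
  by_cases ha : a ∈ equalEdges X <;> by_cases hb : b ∈ equalEdges X <;>
    by_cases hc : c ∈ equalEdges X <;> simp [ha, hb, hc] at h0 ⊢

theorem IsTriangulated.isFaceCocycle_indicator (hD : D.IsTriangulated) (hE : E(G).Finite)
    {S : Set β} (hS : D.IsFaceEven S) :
    D.IsFaceCocycle hE (Sᶜ.indicator (1 : β → ZMod 2)) := by
  classical
  intro f
  obtain ⟨u, v, w, a, b, c, -, -, -, hab, hbc, hca, h, -⟩ := hD.exists_triangle f
  rw [sum_borders_eq hE hab hbc hca h]
  rcases hS f a b c hab hbc hca h with h | h | h | h <;> simp [h] <;> decide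

/-- Every set of edges that meets the boundary of each face in an odd number of edges is the set of
edges with equal spins for some spin configuration. -/
theorem IsTriangulated.exists_equalEdges_eq (hD : D.IsTriangulated) (hV : V(G).Finite)
    (hE : E(G).Finite) {S : Set β} (hSE : S ⊆ E(G)) (hS : D.IsFaceEven S) (v₁ : V(G)) :
    ∃ X : V(G) → ℤˣ, X v₁ = 1 ∧ equalEdges X = S := by
  classical
  obtain ⟨Z, hZ⟩ := hD.exists_coboundary hV hE (hD.isFaceCocycle_indicator hE hS) v₁
  -- Comparing with `Z v₁` normalises the spin at `v₁` to `1`.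
  refine ⟨fun v => if Z v = Z v₁ then 1 else -1, by simp, ?_⟩
  have hZ2 : ∀ x y z : ZMod 2, ((if x = z then (1 : ℤˣ) else -1) = if y = z then 1 else -1) ↔
      x = y := by decide
  have key : ∀ e (u v : V(G)), G.IsLink e u v → (Z u = Z v ↔ e ∈ S) := by
    intro e u v h
    rw [hZ e u v h]
    by_cases he : e ∈ S <;> simp [he]
  ext e
  constructor
  · rintro ⟨u, v, h, hX⟩
    exact (key e u v h).1 ((hZ2 _ _ _).1 hX)
  · intro he
    obtain ⟨u, v, h⟩ := G.exists_isLink_of_mem_edgeSet (hSE he)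
    exact ⟨⟨u, h.left_mem⟩, ⟨v, h.right_mem⟩, h, (hZ2 _ _ _).2 ((key e _ _ h).2 he)⟩

/-- With two spin values, the spin at one end of an edge and its membership in `equalEdges`
determine the spin at the other end; agreement spreads along walks from `v₁`. -/
theorem IsTriangulated.eq_of_equalEdges_eq (hD : D.IsTriangulated) {X Y : V(G) → ℤˣ}
    (h : equalEdges X = equalEdges Y) {v₁ : V(G)} (h₁ : X v₁ = Y v₁) : X = Y := by
  have key : ∀ v, Relation.ReflTransGen G.Adj v₁ v → ∀ hv : v ∈ V(G), X ⟨v, hv⟩ = Y ⟨v, hv⟩ := by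
    intro v hv
    induction hv with
    | refl => exact fun _ => h₁
    | @tail u v _ huv ih =>
      intro hv
      obtain ⟨e, he⟩ := huv
      have h1 := ih he.left_mem
      have h2 := mem_equalEdges_iff (X := X) (u := ⟨u, he.left_mem⟩) (v := ⟨v, hv⟩) he
      rw [h, mem_equalEdges_iff (X := Y) (u := ⟨u, he.left_mem⟩) (v := ⟨v, hv⟩) he, h1] at h2
      have h3 : ∀ x y z : ℤˣ, (z = y ↔ z = x) → x = y := by decide
      exact h3 _ _ _ h2
  exact funext fun v => key v (hD.1.2.1 v₁ v₁.2 v v.2) v.2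

/-! ### The unique completion and the bijection -/

theorem IsTriangulated.isCompletion_iff (hD : D.IsTriangulated) (hV : V(G).Finite)
    (hE : E(G).Finite) {X : V(G) → ℤˣ} {P : D.expandedDual.Subgraph} :
    D.IsCompletion X P ↔ P = D.completion (equalEdges X) := by
  constructor
  · rintro ⟨hP, hX⟩
    have hPc := hD.eq_completion hV hE hP
    rw [hPc, completion_edgeSet_inter_intercity, equalSpin_eq_crossing] at hX
    rw [hPc, (hD.crossing_injOn hV hE (D.crossed_subset P) hX.subset).antisymm
      (hD.crossing_injOn hV hE (equalEdges_subset X) hX.symm.subset)]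
  · rintro rfl
    exact ⟨hD.isPerfectMatching_completion hV hE (hD.isFaceEven_equalEdges hE X),
      by rw [completion_edgeSet_inter_intercity, equalSpin_eq_crossing]⟩

theorem IsTriangulated.matching_eq_completion (hD : D.IsTriangulated) (hV : V(G).Finite)
    (hE : E(G).Finite) (X : V(G) → ℤˣ) : D.matching X = D.completion (equalEdges X) :=
  (hD.isCompletion_iff hV hE).1 (Classical.epsilon_spec ⟨_, (hD.isCompletion_iff hV hE).2 rfl⟩)

end PlaneEmbedding

theorem mainTheorem5 {α β : Type*} (G : Graph α β) (hV : V(G).Finite) (hE : E(G).Finite)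
    (D : PlaneEmbedding G) (hD : D.IsTriangulated) (v₁ : V(G)) :
    (∀ X : V(G) → ℤˣ, ∃! P : D.expandedDual.Subgraph, D.IsCompletion X P) ∧
    (∀ X : V(G) → ℤˣ, D.IsCompletion X (D.matching X)) ∧
    Set.BijOn D.matching {X : V(G) → ℤˣ | X v₁ = 1}
      {P : D.expandedDual.Subgraph | P.IsPerfectMatching} := by
  have hM : ∀ X, D.IsCompletion X (D.matching X) := fun X =>
    (hD.isCompletion_iff hV hE).2 (hD.matching_eq_completion hV hE X)
  refine ⟨fun X => ⟨D.matching X, hM X, fun P hP => ?_⟩, hM, fun X _ => (hM X).1, ?_, ?_⟩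
  · rw [hD.matching_eq_completion hV hE, (hD.isCompletion_iff hV hE).1 hP]
  · intro X hX Y hY h
    -- The intercity part of the matching recovers `equalEdges`.
    have hXY : D.crossing (PlaneEmbedding.equalEdges X) =
        D.crossing (PlaneEmbedding.equalEdges Y) := by
      rw [← D.equalSpin_eq_crossing, ← D.equalSpin_eq_crossing, ← (hM X).2, ← (hM Y).2, h]
    exact hD.eq_of_equalEdges_eq
      ((hD.crossing_injOn hV hE (PlaneEmbedding.equalEdges_subset X) hXY.subset).antisymm
        (hD.crossing_injOn hV hE (PlaneEmbedding.equalEdges_subset Y) hXY.symm.subset))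
      (v₁ := v₁) (Eq.trans hX (Eq.symm hY))
  · intro P hP
    obtain ⟨X, hX, hXP⟩ := hD.exists_equalEdges_eq hV hE (D.crossed_subset P)
      (hD.isFaceEven_crossed hV hE hP) v₁
    refine ⟨X, hX, ?_⟩
    rw [hD.matching_eq_completion hV hE, hXP, ← hD.eq_completion hV hE hP]
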